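/- Let $G$ be the following plane configuration in a disc (a 4-tangle configuration): a plane graph with nine 4-valent vertices $A,B,C,D,E,F,M,L,R$ and eight endpoints on the boundary of the disc. Its fourteen inner edges are $AB,BC,CD,DA$, $EA,EB$, $FC,FD$, $MB,MC$, $ML,MR$, $LE,RF$, and its inner faces are three squares $ABCD$, $EBML$, $FCMR$ and three triangles $EAB$, $FCD$, $MBC$ (so $E$ lies to the left, $F$ to the right of and $M$ below the central square, whose corners are $A$ top left, $B$ bottom left, $C$ bottom right, $D$ top right). The eight endpoints of the disc, in counterclockwise order starting at the left, are joined to $E,L,L,R,R,F,D,A$. A tangle diagram is *supported* by $G$ if, up to planar isotopy relative to the endpoints, it arises from $G$ by replacing each vertex by one of the two possible crossings. A *3-move* replaces two parallel strands of a diagram by three half twists (of either handedness), or conversely. Two tangle diagrams with the same endpoints are *3-move equivalent* if they are related by a finite sequence of planar isotopies relative to the endpoints, Reidemeister moves and 3-moves. **Lemma.** Every tangle diagram supported by $G$ (it has 9 crossings) is 3-move equivalent to a tangle diagram, with the same eight endpoints, that has fewer than 9 crossings. -/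

import Mathlib

/-!
Tangle diagrams in general position with respect to the height function, read from top to bottom.
At every level the diagram meets a horizontal line in finitely many strands, numbered `0, 1, 2, …`
from left to right, and between two consecutive levels exactly one event takes place.  The position
of an event is the number of strands to the left of it.
-/

/-- The events of a tangle diagram: a local maximum (two new neighbouring strands appear), a local
minimum (two neighbouring strands are joined and disappear), or a crossing of two neighbouring
strands.  In `crossing true` the over-strand runs from top left to bottom right, in
`crossing false` it runs from top right to bottom left. -/
inductive PieceKind where
  | maximum : PieceKind
  | minimum : PieceKind
  | crossing (s : Bool) : PieceKind
  deriving DecidableEq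

/-- Number of strands entering an event from above. -/
def PieceKind.ins : PieceKind → ℕ
  | .maximum => 0
  | .minimum => 2
  | .crossing _ => 2

/-- Number of strands leaving an event below. -/
def PieceKind.outs : PieceKind → ℕ
  | .maximum => 2
  | .minimum => 0
  | .crossing _ => 2

/-- An event together with the number of strands to the left of it. -/
structure Piece where
  kind : PieceKind
  pos : ℕ
  deriving DecidableEq

/-- A local maximum creating the strands `i`, `i + 1`. -/
def maxAt (i : ℕ) : Piece := ⟨.maximum, i⟩

/-- A local minimum joining the strands `i`, `i + 1`. -/
def minAt (i : ℕ) : Piece := ⟨.minimum, i⟩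

/-- A crossing of the strands `i`, `i + 1`. -/
def crossAt (i : ℕ) (s : Bool) : Piece := ⟨.crossing s, i⟩

/-- `IsTangleWord m l n`: the events `l`, performed from top to bottom, start with `m` strands, are
all possible, and end with `n` strands. -/
def IsTangleWord : ℕ → List Piece → ℕ → Prop
  | m, [], n => m = n
  | m, x :: l, n =>
      x.pos + x.kind.ins ≤ m ∧ IsTangleWord (m - x.kind.ins + x.kind.outs) l n

/-- An unoriented tangle diagram in a rectangle, with `m` fixed endpoints on the top side and `n`
fixed endpoints on the bottom side.  Closed components are allowed.  A diagram of a `k`-tangle has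
`m + n = 2 * k` endpoints. -/
@[ext] structure TangleDiagram (m n : ℕ) where
  pieces : List Piece
  isTangleWord : IsTangleWord m pieces n

/-- Whether an event is a crossing. -/
def Piece.isCrossing (x : Piece) : Bool :=
  match x.kind with
  | .crossing _ => true
  | _ => false

/-- The number of crossings of a tangle diagram. -/
def TangleDiagram.numCrossings {m n : ℕ} (D : TangleDiagram m n) : ℕ :=
  D.pieces.countP Piece.isCrossing

/-- The local modifications of a sliced diagram which realize planar isotopy (rel boundary). -/
inductive PlanarMove : List Piece → List Piece → Prop
  /-- Two events side by side are performed in either order; `k` is the number of strands between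
  them. -/
  | exchange (a b : PieceKind) (i k : ℕ) :
      PlanarMove [⟨a, i⟩, ⟨b, i + a.outs + k⟩] [⟨b, i + a.ins + k⟩, ⟨a, i⟩]
  /-- Straightening of a zigzag. -/
  | zigzag_right (i : ℕ) : PlanarMove [maxAt i, minAt (i + 1)] []
  /-- Straightening of a zigzag. -/
  | zigzag_left (i : ℕ) : PlanarMove [maxAt (i + 1), minAt i] []
  /-- A crossing slides along a strand through a local minimum. -/
  | slide_min (i : ℕ) (s : Bool) :
      PlanarMove [crossAt (i + 1) s, minAt i] [crossAt i (!s), minAt (i + 1)]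
  /-- A crossing slides along a strand through a local maximum. -/
  | slide_max (i : ℕ) (s : Bool) :
      PlanarMove [maxAt i, crossAt (i + 1) s] [maxAt (i + 1), crossAt i (!s)]

/-- The Reidemeister moves. -/
inductive ReidemeisterMove : List Piece → List Piece → Prop
  | r1_max (i : ℕ) (s : Bool) : ReidemeisterMove [maxAt i, crossAt i s] [maxAt i]
  | r1_min (i : ℕ) (s : Bool) : ReidemeisterMove [crossAt i s, minAt i] [minAt i]
  | r2 (i : ℕ) (s : Bool) : ReidemeisterMove [crossAt i s, crossAt i (!s)] []
  /-- `s`, `t`, `u` are the crossings of the first and second, the first and third, and the second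
  and third strand.  The hypothesis says that the three strands lie at three different heights:
  only `s = u ≠ t` is a cyclic pattern. -/
  | r3 (i : ℕ) (s t u : Bool) (h : s = t ∨ t = u) :
      ReidemeisterMove [crossAt i s, crossAt (i + 1) t, crossAt i u]
        [crossAt (i + 1) u, crossAt i t, crossAt (i + 1) s]

/-- The 3-move: two parallel strands are replaced by three half twists, of either handedness. -/
inductive ThreeMove : List Piece → List Piece → Prop
  | twist (i : ℕ) (s : Bool) : ThreeMove [] [crossAt i s, crossAt i s, crossAt i s]

/-- `D'` arises from `D` by one application of the local modification `R`, the rest of the diagram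
being unchanged. -/
def TangleDiagram.StepBy (R : List Piece → List Piece → Prop) {m n : ℕ}
    (D D' : TangleDiagram m n) : Prop :=
  ∃ u x y v : List Piece, R x y ∧ D.pieces = u ++ x ++ v ∧ D'.pieces = u ++ y ++ v

/-- Planar isotopy of tangle diagrams, relative to the endpoints. -/
def TangleDiagram.PlanarIsotopic {m n : ℕ} (D D' : TangleDiagram m n) : Prop :=
  Relation.EqvGen (TangleDiagram.StepBy PlanarMove) D D'

/-- Two tangle diagrams with the same endpoints are 3-move equivalent if they are related by a
finite sequence of planar isotopies, Reidemeister moves, 3-moves and their inverses. -/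
def TangleDiagram.ThreeMoveEquivalent {m n : ℕ} (D D' : TangleDiagram m n) : Prop :=
  Relation.EqvGen (TangleDiagram.StepBy fun x y =>
    PlanarMove x y ∨ ReidemeisterMove x y ∨ ThreeMove x y) D D'

/-- The events of a sliced plane graph all of whose inner vertices are 4-valent. -/
inductive GraphPiece where
  | maximum (pos : ℕ) : GraphPiece
  | minimum (pos : ℕ) : GraphPiece
  | vertex (pos : ℕ) : GraphPiece
  deriving DecidableEq

/-- Forget which strand of a crossing is the upper one: crossings become 4-valent vertices. -/
def Piece.toGraphPiece : Piece → GraphPiece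
  | ⟨.maximum, i⟩ => .maximum i
  | ⟨.minimum, i⟩ => .minimum i
  | ⟨.crossing _, i⟩ => .vertex i

/-- A configuration: a plane 4-valent graph with endpoints on the boundary, in sliced form. -/
abbrev Configuration := List GraphPiece

/-- The diagram `D` is supported by the configuration `G`: up to planar isotopy it arises from `G`
by choosing one of the two crossings at each vertex of `G`. -/
def TangleDiagram.SupportedBy {m n : ℕ} (D : TangleDiagram m n) (G : Configuration) : Prop :=
  ∃ D' : TangleDiagram m n, D.PlanarIsotopic D' ∧ D'.pieces.map Piece.toGraphPiece = G

/-- The 4-tangle configuration with nine vertices `A, B, C, D, E, F, M, L, R` and eight endpoints,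
four on the top side and four on the bottom side:

```
      1    2     3    4
       \   |     |   /
        \ /A-----D\ /
         E |     | F
        / \B-----C/ \
       |    \   /    |
       |      M      |
       |    /   \    |
        L--       --R
       / \         / \
      5   6       7   8
```

The fourteen edges are `AB, BC, CD, DA, EA, EB, FC, FD, MB, MC, ML, MR, LE, RF`, the six inner
faces are the squares `ABCD`, `EBML`, `FCMR` and the triangles `EAB`, `FCD`, `MBC`, and the endpoints are attached, from left to right, to
`E, A, D, F` on top and to `L, L, R, R` at the bottom. -/
def nineVertexConfiguration : Configuration :=
  [.maximum 2,
   .vertex 1,  -- A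
   .vertex 3,  -- D
   .vertex 0,  -- E
   .vertex 4,  -- F
   .vertex 1,  -- B
   .vertex 3,  -- C
   .minimum 2,
   .vertex 1,  -- M
   .vertex 0,  -- L
   .vertex 2]  -- R

/-! Turning crossings through local maxima and minima shows that a diagram on the configuration is a
braid on four strands with some ends bent round. Read along the braid, the vertices are `L E A B M C
D F R`, so the braid is a word `a b c b a b c b a` in the standard generators with arbitrary signs.
The 3-move makes the cube of each generator trivial, so it suffices to shorten every such signed
word to at most eight letters in the braid group modulo these cubes.

Each inner block `b^± c^± b^±` is either flipped to `c^± b^± c^±` by the braid relation, or it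
alternates in sign. In the second case it equals `Z * c^±`, where `Z = (b c b)²` is the full twist,
which commutes with `b` and `c` and has square `1` modulo cubes (`alternating_eq`,
`fullTwist_mul_self`). With two flipped blocks, two letters `c^±` meet across the middle `a^±` and
merge. With two twists, `Z a Z = Z' c Z'` for the full twist `Z'` of `a` and `b` (`conj_fullTwist`)
trades them for twists that the outer letters `a^±` absorb. In the mixed case, the twist absorbs the
merged `c^±`, or, if that letter cancels, it is combined with the block `a^± b^± a^±`
(`isShort_mul_fullTwist`). -/

/-! ### Braid groups modulo the cubes of the generators -/

section CubicBraid

variable {H : Type*} [Group H]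

/-- The elements `x` and `y` satisfy the braid relation and have order dividing `3`. -/
structure CubicBraidPair (x y : H) : Prop where
  braid : x * y * x = y * x * y
  cube_left : x * x * x = 1
  cube_right : y * y * y = 1

/-- The defining relations of the quotient of the braid group on four strands by the cubes of the
standard generators. -/
structure CubicBraidTriple (a b c : H) : Prop where
  left : CubicBraidPair a b
  right : CubicBraidPair b c
  comm : Commute a c

/-- `x` is a generator `a` or its inverse. -/
def IsSigned (a x : H) : Prop := x = a ∨ x = a⁻¹

theorem IsSigned.inv {a x : H} (h : IsSigned a x) : IsSigned a x⁻¹ := by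
  rcases h with rfl | rfl
  · exact Or.inr rfl
  · exact Or.inl (inv_inv _)

/-- `g` is a product of at most `n` of the elements `a`, `b`, `c` and their inverses. -/
def IsShort (a b c : H) (n : ℕ) (g : H) : Prop :=
  ∃ w : List H, w.length ≤ n ∧ (∀ x ∈ w, IsSigned a x ∨ IsSigned b x ∨ IsSigned c x) ∧ w.prod = g

namespace IsShort

variable {a b c : H}

theorem mul {m n : ℕ} {g k : H} (hg : IsShort a b c m g) (hk : IsShort a b c n k) :
    IsShort a b c (m + n) (g * k) := by
  obtain ⟨w, hw, hw', rfl⟩ := hg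
  obtain ⟨v, hv, hv', rfl⟩ := hk
  refine ⟨w ++ v, by simp only [List.length_append]; omega, ?_, by simp⟩
  intro x hx
  rcases List.mem_append.1 hx with hx | hx
  exacts [hw' x hx, hv' x hx]

theorem mono {m n : ℕ} {g : H} (hg : IsShort a b c m g) (h : m ≤ n) : IsShort a b c n g := by
  obtain ⟨w, hw, hw'⟩ := hg
  exact ⟨w, hw.trans h, hw'⟩

theorem inv {n : ℕ} {g : H} (hg : IsShort a b c n g) : IsShort a b c n g⁻¹ := by
  obtain ⟨w, hw, hw', rfl⟩ := hg
  refine ⟨(w.map (·⁻¹)).reverse, by simpa using hw, ?_, by rw [List.prod_inv_reverse]⟩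
  intro x hx
  obtain ⟨y, hy, rfl⟩ := List.mem_map.1 (List.mem_reverse.1 hx)
  rcases hw' y hy with h | h | h
  exacts [Or.inl h.inv, Or.inr (Or.inl h.inv), Or.inr (Or.inr h.inv)]

theorem one : IsShort a b c 0 1 := ⟨[], by simp⟩

theorem of_left {x : H} (h : IsSigned a x) : IsShort a b c 1 x := ⟨[x], by simp [h]⟩

theorem of_mid {x : H} (h : IsSigned b x) : IsShort a b c 1 x := ⟨[x], by simp [h]⟩

theorem of_right {x : H} (h : IsSigned c x) : IsShort a b c 1 x := ⟨[x], by simp [h]⟩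

end IsShort

theorem inv_mul_inv_of_cube {x : H} (h : x * x * x = 1) : x⁻¹ * x⁻¹ = x := by
  rw [← mul_inv_rev, inv_eq_iff_mul_eq_one, h]

theorem mul_self_of_cube {x : H} (h : x * x * x = 1) : x * x = x⁻¹ :=
  eq_inv_of_mul_eq_one_left h

/-! ### Three strands: flips and the full twist -/

namespace CubicBraidPair

variable {x y : H}

theorem swap (h : CubicBraidPair x y) : CubicBraidPair y x :=
  ⟨h.braid.symm, h.cube_right, h.cube_left⟩

theorem conj_left (h : CubicBraidPair x y) : x * y * x⁻¹ = y⁻¹ * x * y := by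
  rw [mul_inv_eq_iff_eq_mul, mul_assoc, mul_assoc, eq_inv_mul_iff_mul_eq, ← mul_assoc, ← mul_assoc,
    h.braid]

/-- A product of the form `x^± y^± x^±` either can be flipped by the braid relation, or it is
alternating. -/
theorem flip_or_alternating (h : CubicBraidPair x y) {p q r : H} (hp : IsSigned x p)
    (hq : IsSigned y q) (hr : IsSigned x r) :
    (∃ p' q' r', IsSigned y p' ∧ IsSigned x q' ∧ IsSigned y r' ∧ p * q * r = p' * q' * r') ∨
      p * q * r = x * y⁻¹ * x ∨ p * q * r = x⁻¹ * y * x⁻¹ := by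
  have key : ∀ {s t u : H}, IsSigned y s → IsSigned x t → IsSigned y u → p * q * r = s * t * u →
      ∃ p' q' r', IsSigned y p' ∧ IsSigned x q' ∧ IsSigned y r' ∧ p * q * r = p' * q' * r' :=
    fun hs ht hu e => ⟨_, _, _, hs, ht, hu, e⟩
  -- Six of the eight sign patterns flip: the braid relation, its two conjugation forms, and the
  -- inverses of these three. Only the alternating patterns remain.
  have e₁ := h.conj_left
  have e₂ := h.swap.conj_left
  rcases hp with rfl | rfl <;> rcases hq with rfl | rfl <;> rcases hr with rfl | rfl
  · exact Or.inl (key (Or.inl rfl) (Or.inl rfl) (Or.inl rfl) h.braid)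
  · exact Or.inl (key (Or.inr rfl) (Or.inl rfl) (Or.inl rfl) e₁)
  · exact Or.inr (Or.inl rfl)
  · refine Or.inl (key (Or.inr rfl) (Or.inr rfl) (Or.inl rfl) ?_)
    simpa [mul_assoc] using congrArg (·⁻¹) e₁
  · exact Or.inl (key (Or.inl rfl) (Or.inl rfl) (Or.inr rfl) e₂.symm)
  · exact Or.inr (Or.inr rfl)
  · refine Or.inl (key (Or.inl rfl) (Or.inr rfl) (Or.inr rfl) ?_)
    simpa [mul_assoc] using congrArg (·⁻¹) e₂.symm
  · refine Or.inl (key (Or.inr rfl) (Or.inr rfl) (Or.inr rfl) ?_)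
    simpa [mul_assoc] using congrArg (·⁻¹) h.braid

/-- The full twist of a pair of generators. -/
def fullTwist (x y : H) : H := x * y * x * (x * y * x)

theorem fullTwist_swap (h : CubicBraidPair x y) : fullTwist y x = fullTwist x y := by
  rw [fullTwist, fullTwist, h.braid]

/-- The half twist `x y x` carries `y` to `x` and `x` to `y`, so its square commutes with both. -/
theorem commute_fullTwist (h : CubicBraidPair x y) : Commute (fullTwist x y) x := by
  have e : x * y * x * y = x * (x * y * x) := by
    rw [mul_assoc x y x, mul_assoc x, ← h.braid, mul_assoc x y x]
  calc x * y * x * (x * y * x) * x = x * y * x * (y * x * y * x) := by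
        rw [← h.braid]; simp only [mul_assoc]
    _ = x * y * x * y * (x * y * x) := by simp only [mul_assoc]
    _ = x * (x * y * x * (x * y * x)) := by rw [e]; simp only [mul_assoc]

theorem commute_fullTwist' (h : CubicBraidPair x y) : Commute (fullTwist x y) y := by
  rw [← h.fullTwist_swap]; exact h.swap.commute_fullTwist

/-- By the braid relation the full twist is `(y x y)(y x y)`, whose middle `y * y` is `y⁻¹`.
Stripping the outer letters leaves `y⁻¹ * y⁻¹ = y` beside the central twist. -/
theorem alternating_eq (h : CubicBraidPair x y) : x * y⁻¹ * x = fullTwist x y * y := by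
  have e : fullTwist x y = y * (x * y⁻¹ * x) * y := by
    rw [fullTwist, h.braid, ← mul_self_of_cube h.cube_right]; simp only [mul_assoc]
  have e' : x * y⁻¹ * x = y⁻¹ * fullTwist x y * y⁻¹ := by rw [e]; group
  rw [e', ← h.commute_fullTwist'.inv_right.eq, mul_assoc, inv_mul_inv_of_cube h.cube_right]

theorem alternating_mul_eq (h : CubicBraidPair x y) : x * y⁻¹ * x * y⁻¹ = fullTwist x y := by
  rw [h.alternating_eq, mul_inv_cancel_right]

/-- The twist has the two expressions `x y⁻¹ x y⁻¹` and `y x⁻¹ y x⁻¹`, which are inverse to each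
other. -/
theorem fullTwist_mul_self (h : CubicBraidPair x y) : fullTwist x y * fullTwist x y = 1 := by
  nth_rw 2 [← h.fullTwist_swap]
  rw [← h.alternating_mul_eq, ← h.swap.alternating_mul_eq]
  group

theorem inv_fullTwist (h : CubicBraidPair x y) : (fullTwist x y)⁻¹ = fullTwist x y :=
  inv_eq_of_mul_eq_one_left h.fullTwist_mul_self

theorem alternating_inv_eq (h : CubicBraidPair x y) : x⁻¹ * y * x⁻¹ = fullTwist x y * y⁻¹ := by
  have e := congrArg (·⁻¹) h.alternating_eq
  simp only [mul_inv_rev, inv_inv, h.inv_fullTwist] at e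
  rw [h.commute_fullTwist'.inv_right.eq, ← e, mul_assoc]

theorem alternating_eq' (h : CubicBraidPair x y) : y * x⁻¹ * y = fullTwist x y * x := by
  rw [h.swap.alternating_eq, h.fullTwist_swap]

theorem alternating_inv_eq' (h : CubicBraidPair x y) : y⁻¹ * x * y⁻¹ = fullTwist x y * x⁻¹ := by
  rw [h.swap.alternating_inv_eq, h.fullTwist_swap]

end CubicBraidPair

/-! ### Four strands: shortening the nine-letter word -/

namespace CubicBraidTriple

open CubicBraidPair

variable {a b c : H}

theorem commute_signed (h : CubicBraidTriple a b c) {u v : H} (hu : IsSigned a u)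
    (hv : IsSigned c v) : Commute u v := by
  rcases hu with rfl | rfl <;> rcases hv with rfl | rfl
  exacts [h.comm, h.comm.inv_right, h.comm.inv_left, h.comm.inv_inv]

/-- The two twists are expanded as `c b⁻¹ c b⁻¹` and `b c⁻¹ b c⁻¹`, which puts `b⁻¹ a b = a b a⁻¹`
in the middle. Commuting `a` past `c` then exposes the alternating words `b⁻¹ a b⁻¹` and `b a⁻¹ b`,
which yield the twists of `a` and `b`. -/
theorem conj_fullTwist_aux (h : CubicBraidTriple a b c) :
    fullTwist b c * a * fullTwist b c =
      c * (fullTwist a b * c * fullTwist a b) * c⁻¹ := by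
  have e₁ : b⁻¹ * a * b = a * b * a⁻¹ := h.left.conj_left.symm
  have e₂ : c * b * c⁻¹ = b⁻¹ * c * b := h.right.swap.conj_left
  have z₁ : fullTwist b c = c * b⁻¹ * c * b⁻¹ := by
    rw [h.right.swap.alternating_mul_eq, h.right.fullTwist_swap]
  have z₂ : fullTwist b c = b * c⁻¹ * b * c⁻¹ := h.right.alternating_mul_eq.symm
  have ac : c * a = a * c := h.comm.eq.symm
  have ac' : a⁻¹ * c⁻¹ = c⁻¹ * a⁻¹ := h.comm.inv_inv.eq
  calc fullTwist b c * a * fullTwist b c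
      = c * b⁻¹ * c * (b⁻¹ * a * b) * c⁻¹ * b * c⁻¹ := by
        nth_rw 1 [z₁]; rw [z₂]; simp only [mul_assoc]
    _ = c * b⁻¹ * (c * a) * b * (a⁻¹ * c⁻¹) * b * c⁻¹ := by rw [e₁]; simp only [mul_assoc]
    _ = c * b⁻¹ * a * (c * b * c⁻¹) * a⁻¹ * b * c⁻¹ := by rw [ac, ac']; simp only [mul_assoc]
    _ = c * (b⁻¹ * a * b⁻¹) * c * (b * a⁻¹ * b) * c⁻¹ := by rw [e₂]; simp only [mul_assoc]
    _ = c * (fullTwist a b * (a⁻¹ * c * a) * fullTwist a b) * c⁻¹ := by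
        rw [h.left.alternating_inv_eq', h.left.alternating_eq', h.left.commute_fullTwist.eq]
        simp only [mul_assoc]
    _ = _ := by rw [mul_assoc a⁻¹, ac, inv_mul_cancel_left]

/-- The left side commutes with `c`, because the twist and `a` do, so the conjugation by `c` in
`conj_fullTwist_aux` has no effect. -/
theorem conj_fullTwist (h : CubicBraidTriple a b c) :
    fullTwist b c * a * fullTwist b c = fullTwist a b * c * fullTwist a b := by
  have e := h.conj_fullTwist_aux
  have hc : Commute (fullTwist b c) c := h.right.commute_fullTwist'
  have : Commute (fullTwist b c * a * fullTwist b c) c := (hc.mul_left h.comm).mul_left hc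
  have e' : fullTwist a b * c * fullTwist a b = c⁻¹ * (fullTwist b c * a * fullTwist b c) * c := by
    rw [e]; group
  rw [e', mul_assoc c⁻¹, this.eq, inv_mul_cancel_left]

theorem conj_fullTwist_signed (h : CubicBraidTriple a b c) {x : H} (hx : IsSigned a x) :
    ∃ y, IsSigned c y ∧ fullTwist b c * x * fullTwist b c = fullTwist a b * y * fullTwist a b := by
  rcases hx with rfl | rfl
  · exact ⟨c, Or.inl rfl, h.conj_fullTwist⟩
  · refine ⟨c⁻¹, Or.inr rfl, ?_⟩
    have e := congrArg (·⁻¹) h.conj_fullTwist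
    simpa only [mul_inv_rev, h.left.inv_fullTwist, h.right.inv_fullTwist, mul_assoc] using e

theorem isShort_mul_right (h : CubicBraidTriple a b c) {x y : H} (hx : IsSigned c x)
    (hy : IsSigned c y) : IsShort a b c 1 (x * y) := by
  have hcube := h.right.cube_right
  rcases hx with rfl | rfl <;> rcases hy with rfl | rfl
  · rw [mul_self_of_cube hcube]; exact .of_right (Or.inr rfl)
  · rw [mul_inv_cancel]; exact IsShort.one.mono zero_le_one
  · rw [inv_mul_cancel]; exact IsShort.one.mono zero_le_one
  · rw [inv_mul_inv_of_cube hcube]; exact .of_right (Or.inl rfl)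

/-- A full twist times a signed letter of its own pair is an alternating word, so together they cost
only three letters. -/
theorem isShort_fullTwist_mul_left (h : CubicBraidTriple a b c) {x : H} (hx : IsSigned a x) :
    IsShort a b c 3 (fullTwist a b * x) := by
  rcases hx with rfl | rfl
  · rw [← h.left.alternating_eq']
    exact ((IsShort.of_mid (Or.inl rfl)).mul (.of_left (Or.inr rfl))).mul (.of_mid (Or.inl rfl))
  · rw [← h.left.alternating_inv_eq']
    exact ((IsShort.of_mid (Or.inr rfl)).mul (.of_left (Or.inl rfl))).mul (.of_mid (Or.inr rfl))

theorem isShort_fullTwist_mul_right (h : CubicBraidTriple a b c) {x : H} (hx : IsSigned c x) :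
    IsShort a b c 3 (fullTwist b c * x) := by
  rcases hx with rfl | rfl
  · rw [← h.right.alternating_eq]
    exact ((IsShort.of_mid (Or.inl rfl)).mul (.of_right (Or.inr rfl))).mul (.of_mid (Or.inl rfl))
  · rw [← h.right.alternating_inv_eq]
    exact ((IsShort.of_mid (Or.inr rfl)).mul (.of_right (Or.inl rfl))).mul (.of_mid (Or.inr rfl))

theorem isShort_left_fullTwist_mul_mid (h : CubicBraidTriple a b c) {x : H}
    (hx : IsSigned b x) : IsShort a b c 3 (fullTwist a b * x) := by
  rcases hx with rfl | rfl
  · rw [← h.left.alternating_eq]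
    exact ((IsShort.of_left (Or.inl rfl)).mul (.of_mid (Or.inr rfl))).mul (.of_left (Or.inl rfl))
  · rw [← h.left.alternating_inv_eq]
    exact ((IsShort.of_left (Or.inr rfl)).mul (.of_mid (Or.inl rfl))).mul (.of_left (Or.inr rfl))

theorem isShort_fullTwist_mul_mid (h : CubicBraidTriple a b c) {x : H} (hx : IsSigned b x) :
    IsShort a b c 3 (fullTwist b c * x) := by
  rcases hx with rfl | rfl
  · rw [← h.right.alternating_eq']
    exact ((IsShort.of_right (Or.inl rfl)).mul (.of_mid (Or.inr rfl))).mul (.of_right (Or.inl rfl))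
  · rw [← h.right.alternating_inv_eq']
    exact ((IsShort.of_right (Or.inr rfl)).mul (.of_mid (Or.inl rfl))).mul (.of_right (Or.inr rfl))

/-- Both middle blocks are flipped. -/
theorem isShort_of_flip_flip (h : CubicBraidTriple a b c) {l m r p q s p' q' s' : H}
    (hl : IsSigned a l) (hm : IsSigned a m) (hr : IsSigned a r) (hp : IsSigned c p)
    (hq : IsSigned b q) (hs : IsSigned c s) (hp' : IsSigned c p') (hq' : IsSigned b q')
    (hs' : IsSigned c s') :
    IsShort a b c 8 (l * (p * q * s) * m * (p' * q' * s') * r) := by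
  have comm {u v : H} (hu : IsSigned a u) (hv : IsSigned c v) := (h.commute_signed hu hv).eq
  -- The letter `m` commutes with `s` and `p'`, which become neighbours and merge into at most one
  -- letter.
  have e : l * (p * q * s) * m * (p' * q' * s') * r =
      p * l * q * m * (s * p') * q' * r * s' := by
    calc _ = (l * p) * q * (s * (m * p')) * q' * (s' * r) := by simp only [mul_assoc]
      _ = (l * p) * q * ((s * p') * m) * q' * (s' * r) := by
        rw [comm hm hp', mul_assoc s]
      _ = (p * l) * q * (m * (s * p')) * q' * (r * s') := by
        rw [comm hl hp, comm hr hs', mul_assoc s, ← comm hm hp', ← mul_assoc s m, ← comm hm hs]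
        simp only [mul_assoc]
      _ = _ := by simp only [mul_assoc]
  rw [e]
  exact (((((((IsShort.of_right hp).mul (.of_left hl)).mul (.of_mid hq)).mul (.of_left hm)).mul
    (h.isShort_mul_right hs hp')).mul (.of_mid hq')).mul (.of_left hr)).mul (.of_right hs')

/-- Both middle blocks are alternating. -/
theorem isShort_of_twist_twist (h : CubicBraidTriple a b c) {l m r s s' : H}
    (hl : IsSigned a l) (hm : IsSigned a m) (hr : IsSigned a r) (hs : IsSigned c s)
    (hs' : IsSigned c s') :
    IsShort a b c 8 (l * (fullTwist b c * s) * m * (fullTwist b c * s') * r) := by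
  obtain ⟨y, hy, e⟩ := h.conj_fullTwist_signed hm
  have zc : ∀ {v : H}, IsSigned c v → Commute (fullTwist b c) v := by
    rintro v (rfl | rfl)
    exacts [h.right.commute_fullTwist', h.right.commute_fullTwist'.inv_right]
  have za : ∀ {v : H}, IsSigned a v → Commute (fullTwist a b) v := by
    rintro v (rfl | rfl)
    exacts [h.left.commute_fullTwist, h.left.commute_fullTwist.inv_right]
  -- Both `s` and `s'` move to the front, leaving `m` between two twists. After the trade the count
  -- is 1 + 3 + 1 + 3.
  have e' : l * (fullTwist b c * s) * m * (fullTwist b c * s') * r =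
      s * s' * (fullTwist a b * l) * y * (fullTwist a b * r) := by
    have hs₁ : Commute (l * fullTwist b c) s := (h.commute_signed hl hs).mul_left (zc hs)
    have hs₂ : Commute (l * (fullTwist b c * m * fullTwist b c)) s' :=
      (h.commute_signed hl hs').mul_left
        (((zc hs').mul_left (h.commute_signed hm hs')).mul_left (zc hs'))
    calc _ = (l * fullTwist b c * s) * m * fullTwist b c * s' * r := by simp only [mul_assoc]
      _ = s * (l * (fullTwist b c * m * fullTwist b c) * s') * r := by
        rw [hs₁.eq]; simp only [mul_assoc]
      _ = s * s' * (l * fullTwist a b) * y * (fullTwist a b * r) := by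
        rw [hs₂.eq, e]; simp only [mul_assoc]
      _ = _ := by rw [← (za hl).eq]
  rw [e']
  exact (((h.isShort_mul_right hs hs').mul (h.isShort_fullTwist_mul_left hl)).mul
    (.of_right hy)).mul (h.isShort_fullTwist_mul_left hr)

/-- A flipped block followed by a full twist. -/
theorem isShort_mul_fullTwist (h : CubicBraidTriple a b c) {l q m : H}
    (hl : IsSigned a l) (hq : IsSigned b q) (hm : IsSigned a m) :
    IsShort a b c 6 (l * q * m * fullTwist b c) := by
  have zb : Commute (fullTwist b c) b := h.right.commute_fullTwist
  rcases h.left.flip_or_alternating hl hq hm with ⟨u, v, w, hu, hv, hw, e⟩ | e | e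
  · have : Commute (fullTwist b c) w := by
      rcases hw with rfl | rfl
      exacts [zb, zb.inv_right]
    rw [e, mul_assoc, ← this.eq]
    exact (((IsShort.of_mid hu).mul (.of_left hv)).mul (h.isShort_fullTwist_mul_mid hw)).mono
      (by norm_num)
  · rw [e, h.left.alternating_eq]
    -- Writing `b = b⁻¹ * b⁻¹` gives each of the two twists a letter to absorb, at three letters
    -- each.
    have e' : fullTwist a b * b * fullTwist b c =
        fullTwist a b * b⁻¹ * (fullTwist b c * b⁻¹) := by
      rw [zb.inv_right.eq, ← mul_assoc, mul_assoc _ b⁻¹ b⁻¹,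
        inv_mul_inv_of_cube h.left.cube_right]
    rw [e']
    exact (h.isShort_left_fullTwist_mul_mid (Or.inr rfl)).mul
      (h.isShort_fullTwist_mul_mid (Or.inr rfl))
  · rw [e, h.left.alternating_inv_eq, ← mul_self_of_cube h.left.cube_right, ← mul_assoc,
      mul_assoc _ b (fullTwist b c), ← zb.eq]
    exact (h.isShort_left_fullTwist_mul_mid (Or.inl rfl)).mul
      (h.isShort_fullTwist_mul_mid (Or.inl rfl))

/-- The first middle block is flipped, the second one alternating. -/
theorem isShort_of_flip_twist (h : CubicBraidTriple a b c) {l m r p q s s' : H}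
    (hl : IsSigned a l) (hm : IsSigned a m) (hr : IsSigned a r) (hp : IsSigned c p)
    (hq : IsSigned b q) (hs : IsSigned c s) (hs' : IsSigned c s') :
    IsShort a b c 8 (l * (p * q * s) * m * (fullTwist b c * s') * r) := by
  have hcube := h.right.cube_right
  have e : l * (p * q * s) * m * (fullTwist b c * s') * r =
      p * (l * q * m * (fullTwist b c * (s * s'))) * r := by
    have hz : s * fullTwist b c = fullTwist b c * s := by
      rcases hs with rfl | rfl
      exacts [h.right.commute_fullTwist'.eq.symm, h.right.commute_fullTwist'.inv_right.eq.symm]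
    calc _ = (l * p) * q * (s * m) * fullTwist b c * s' * r := by simp only [mul_assoc]
      _ = p * l * q * m * (s * fullTwist b c) * s' * r := by
        rw [(h.commute_signed hl hp).eq, ← (h.commute_signed hm hs).eq]; simp only [mul_assoc]
      _ = _ := by rw [hz]; simp only [mul_assoc]
  -- If `s * s'` is a letter, the twist absorbs it: 1 + (1 + 1 + 1 + 3) + 1.
  have merged : ∀ {t : H}, IsSigned c t → s * s' = t →
      IsShort a b c 8 (p * (l * q * m * (fullTwist b c * (s * s'))) * r) := by
    rintro t ht rfl
    exact ((IsShort.of_right hp).mul ((((IsShort.of_left hl).mul (.of_mid hq)).mul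
      (.of_left hm)).mul (h.isShort_fullTwist_mul_right ht))).mul (.of_left hr)
  -- The twist has no letter `c^±` left to absorb, so it is combined with `l * q * m`: 1 + 6 + 1.
  have cancelled : s * s' = 1 →
      IsShort a b c 8 (p * (l * q * m * (fullTwist b c * (s * s'))) * r) := by
    intro hss
    rw [hss, mul_one]
    exact ((IsShort.of_right hp).mul (h.isShort_mul_fullTwist hl hq hm)).mul (.of_left hr)
  rw [e]
  rcases hs with rfl | rfl <;> rcases hs' with rfl | rfl
  · exact merged (Or.inr rfl) (mul_self_of_cube hcube)
  · exact cancelled (mul_inv_cancel _)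
  · exact cancelled (inv_mul_cancel _)
  · exact merged (Or.inl rfl) (inv_mul_inv_of_cube hcube)

theorem flip_or_twist (h : CubicBraidTriple a b c) {p q r : H} (hp : IsSigned b p)
    (hq : IsSigned c q) (hr : IsSigned b r) :
    (∃ p' q' r', IsSigned c p' ∧ IsSigned b q' ∧ IsSigned c r' ∧ p * q * r = p' * q' * r') ∨
      ∃ s, IsSigned c s ∧ p * q * r = fullTwist b c * s := by
  rcases h.right.flip_or_alternating hp hq hr with H | H | H
  · exact Or.inl H
  · exact Or.inr ⟨c, Or.inl rfl, H.trans h.right.alternating_eq⟩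
  · exact Or.inr ⟨c⁻¹, Or.inr rfl, H.trans h.right.alternating_inv_eq⟩

/-- Every signed word `a b c b a b c b a` is equal to a word of length at most eight. -/
theorem isShort_nine (h : CubicBraidTriple a b c) {x₁ x₂ x₃ x₄ x₅ x₆ x₇ x₈ x₉ : H}
    (h₁ : IsSigned a x₁) (h₂ : IsSigned b x₂) (h₃ : IsSigned c x₃) (h₄ : IsSigned b x₄)
    (h₅ : IsSigned a x₅) (h₆ : IsSigned b x₆) (h₇ : IsSigned c x₇) (h₈ : IsSigned b x₈)
    (h₉ : IsSigned a x₉) :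
    IsShort a b c 8 (x₁ * (x₂ * x₃ * x₄) * x₅ * (x₆ * x₇ * x₈) * x₉) := by
  rcases h.flip_or_twist h₂ h₃ h₄ with ⟨p, q, s, hp, hq, hs, e⟩ | ⟨s, hs, e⟩
  · rw [e]
    rcases h.flip_or_twist h₆ h₇ h₈ with ⟨p', q', s', hp', hq', hs', e'⟩ | ⟨s', hs', e'⟩
    · rw [e']
      exact h.isShort_of_flip_flip h₁ h₅ h₉ hp hq hs hp' hq' hs'
    · rw [e']
      exact h.isShort_of_flip_twist h₁ h₅ h₉ hp hq hs hs'
  · rcases h.flip_or_twist h₆ h₇ h₈ with ⟨p', q', s', hp', hq', hs', e'⟩ | ⟨s', hs', e'⟩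
    · have hs'' : (fullTwist b c * s)⁻¹ = fullTwist b c * s⁻¹ := by
        rw [mul_inv_rev, h.right.inv_fullTwist]
        rcases hs with rfl | rfl
        · exact h.right.commute_fullTwist'.inv_right.eq.symm
        · rw [inv_inv]; exact h.right.commute_fullTwist'.eq.symm
      have key := (h.isShort_of_flip_twist h₉.inv h₅.inv h₁.inv hs'.inv hq'.inv hp'.inv hs.inv).inv
      rw [← hs''] at key
      rw [e, e']
      simpa only [mul_inv_rev, inv_inv, mul_assoc] using key
    · rw [e, e']
      exact h.isShort_of_twist_twist h₁ h₅ h₉ hs hs'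

end CubicBraidTriple

end CubicBraid

/-! ### Isotopies of sliced diagrams -/

section TangleDiagrams

theorem isTangleWord_append {u v : List Piece} {m n : ℕ} :
    IsTangleWord m (u ++ v) n ↔ ∃ k, IsTangleWord m u k ∧ IsTangleWord k v n := by
  induction u generalizing m with
  | nil => simp [IsTangleWord]
  | cons x u ih => simp [IsTangleWord, ih, and_assoc]

namespace TangleDiagram

variable {m n : ℕ}

theorem PlanarIsotopic.threeMoveEquivalent {D D' : TangleDiagram m n} (h : D.PlanarIsotopic D') :
    D.ThreeMoveEquivalent D' := by
  refine Relation.EqvGen.mono ?_ _ _ h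
  rintro D D' ⟨u, x, y, v, hR, h⟩
  exact ⟨u, x, y, v, Or.inl hR, h⟩

theorem PlanarIsotopic.numCrossings_eq {D D' : TangleDiagram m n} (h : D.PlanarIsotopic D') :
    D.numCrossings = D'.numCrossings := by
  induction h with
  | rel D D' h =>
    obtain ⟨u, x, y, v, hR, h, h'⟩ := h
    have : x.countP Piece.isCrossing = y.countP Piece.isCrossing := by
      cases hR with
      | exchange a b i k => cases a <;> cases b <;> rfl
      | zigzag_right i => rfl
      | zigzag_left i => rfl
      | slide_min i s => rfl
      | slide_max i s => rfl
    simp only [numCrossings, h, h', List.countP_append, this]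
  | refl => rfl
  | symm _ _ _ ih => exact ih.symm
  | trans _ _ _ _ _ ih ih' => exact ih.trans ih'

end TangleDiagram

/-- The words `x` and `y` describe planar isotopic tangle diagrams from `m` to `n` points. -/
def IsotopicWords (m n : ℕ) (x y : List Piece) : Prop :=
  ∃ (hx : IsTangleWord m x n) (hy : IsTangleWord m y n),
    (⟨x, hx⟩ : TangleDiagram m n).PlanarIsotopic ⟨y, hy⟩

namespace IsotopicWords

variable {m n : ℕ} {x y z : List Piece}

theorem refl (hx : IsTangleWord m x n) : IsotopicWords m n x x :=
  ⟨hx, hx, .refl _⟩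

theorem symm (h : IsotopicWords m n x y) : IsotopicWords m n y x := by
  obtain ⟨hx, hy, h⟩ := h
  exact ⟨hy, hx, .symm _ _ h⟩

theorem trans (h : IsotopicWords m n x y) (h' : IsotopicWords m n y z) :
    IsotopicWords m n x z := by
  obtain ⟨hx, hy, h⟩ := h
  obtain ⟨_, hz, h'⟩ := h'
  exact ⟨hx, hz, .trans _ _ _ h h'⟩

theorem of_move (u v : List Piece) (h : PlanarMove x y) (hx : IsTangleWord m (u ++ x ++ v) n)
    (hy : IsTangleWord m (u ++ y ++ v) n) : IsotopicWords m n (u ++ x ++ v) (u ++ y ++ v) :=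
  ⟨hx, hy, .rel _ _ ⟨u, x, y, v, h, rfl, rfl⟩⟩

/-- Isotopies of a part of a diagram extend to the whole diagram. -/
theorem context {k l : ℕ} {u v : List Piece} (hu : IsTangleWord m u k) (hv : IsTangleWord l v n)
    (h : IsotopicWords k l x y) : IsotopicWords m n (u ++ x ++ v) (u ++ y ++ v) := by
  have valid : ∀ {w}, IsTangleWord k w l → IsTangleWord m (u ++ w ++ v) n := fun hw =>
    isTangleWord_append.2 ⟨l, isTangleWord_append.2 ⟨k, hu, hw⟩, hv⟩
  obtain ⟨hx, hy, h⟩ := h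
  suffices H : ∀ D D' : TangleDiagram k l, D.PlanarIsotopic D' →
      (⟨_, valid D.isTangleWord⟩ : TangleDiagram m n).PlanarIsotopic
        ⟨_, valid D'.isTangleWord⟩ from ⟨valid hx, valid hy, H _ _ h⟩
  intro D D' h
  induction h with
  | rel D D' h =>
    obtain ⟨u', x, y, v', hR, h, h'⟩ := h
    exact .rel _ _ ⟨u ++ u', x, y, v' ++ v, hR, by simp [h], by simp [h']⟩
  | refl => exact .refl _
  | symm _ _ _ ih => exact .symm _ _ ih
  | trans _ _ _ _ _ ih ih' => exact .trans _ _ _ ih ih'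

end IsotopicWords

/-- Every tangle diagram described by the word `x` is planar isotopic to one described by `y`. -/
def IsotopesTo (x y : List Piece) : Prop :=
  ∀ m n, IsTangleWord m x n → IsotopicWords m n x y

namespace IsotopesTo

variable {x y z : List Piece}

theorem refl (x : List Piece) : IsotopesTo x x := fun _ _ hx => .refl hx

theorem trans (h : IsotopesTo x y) (h' : IsotopesTo y z) : IsotopesTo x z := fun m n hx =>
  (h m n hx).trans (h' m n (h m n hx).2.1)

instance : Trans IsotopesTo IsotopesTo IsotopesTo := ⟨trans⟩

theorem context (u v : List Piece) (h : IsotopesTo x y) :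
    IsotopesTo (u ++ x ++ v) (u ++ y ++ v) := by
  intro m n hx
  obtain ⟨l, hx, hv⟩ := isTangleWord_append.1 hx
  obtain ⟨k, hu, hx⟩ := isTangleWord_append.1 hx
  exact (h k l hx).context hu hv

/-- Validity has to pass only from `x` to `y`. A zigzag can always be removed, but inserting one
requires a strand at that place, so `IsotopesTo` is not symmetric and chains run towards fewer
zigzags. -/
theorem of_move (h : PlanarMove x y)
    (valid : ∀ {m n}, IsTangleWord m x n → IsTangleWord m y n) : IsotopesTo x y := by
  intro m n hx
  simpa using IsotopicWords.of_move [] [] h (by simpa using hx) (by simpa using valid hx)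

theorem of_move_symm (h : PlanarMove y x)
    (valid : ∀ {m n}, IsTangleWord m x n → IsTangleWord m y n) : IsotopesTo x y := by
  intro m n hx
  have := IsotopicWords.of_move (m := m) (n := n) [] [] h (by simpa using valid hx)
    (by simpa using hx)
  simpa using this.symm

theorem exchange (a b : PieceKind) (i k : ℕ) :
    IsotopesTo [⟨a, i⟩, ⟨b, i + a.outs + k⟩] [⟨b, i + a.ins + k⟩, ⟨a, i⟩] := by
  refine of_move (.exchange a b i k) ?_
  intro m n h
  simp only [IsTangleWord] at h ⊢
  omega

theorem exchange_symm (a b : PieceKind) (i k : ℕ) :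
    IsotopesTo [⟨b, i + a.ins + k⟩, ⟨a, i⟩] [⟨a, i⟩, ⟨b, i + a.outs + k⟩] := by
  refine of_move_symm (.exchange a b i k) ?_
  intro m n h
  simp only [IsTangleWord] at h ⊢
  omega

theorem slide_min (i : ℕ) {s t : Bool} (h : t = !s) :
    IsotopesTo [crossAt (i + 1) s, minAt i] [crossAt i t, minAt (i + 1)] := by
  subst h
  refine of_move (.slide_min i s) ?_
  intro m n h
  simp only [IsTangleWord, crossAt, minAt, PieceKind.ins, PieceKind.outs] at h ⊢
  omega

theorem slide_min_symm (i : ℕ) {s t : Bool} (h : t = !s) :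
    IsotopesTo [crossAt i s, minAt (i + 1)] [crossAt (i + 1) t, minAt i] := by
  subst h
  refine of_move_symm (by simpa using PlanarMove.slide_min i (!s)) ?_
  intro m n h
  simp only [IsTangleWord, crossAt, minAt, PieceKind.ins, PieceKind.outs] at h ⊢
  omega

theorem slide_max (i : ℕ) {s t : Bool} (h : t = !s) :
    IsotopesTo [maxAt i, crossAt (i + 1) s] [maxAt (i + 1), crossAt i t] := by
  subst h
  refine of_move (.slide_max i s) ?_
  intro m n h
  simp only [IsTangleWord, crossAt, maxAt, PieceKind.ins, PieceKind.outs] at h ⊢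
  omega

theorem zigzag_right (i : ℕ) : IsotopesTo [maxAt i, minAt (i + 1)] [] := by
  refine of_move (.zigzag_right i) ?_
  intro m n h
  simp only [IsTangleWord, minAt, maxAt, PieceKind.ins, PieceKind.outs] at h ⊢
  omega

/-- An event is postponed until all events of a word to the right of it have been performed. -/
theorem exchange_word (a : PieceKind) (i : ℕ) (v : List Piece) :
    IsotopesTo (⟨a, i⟩ :: v.map fun p => ⟨p.kind, i + a.outs + p.pos⟩)
      ((v.map fun p => ⟨p.kind, i + a.ins + p.pos⟩) ++ [⟨a, i⟩]) := by
  induction v with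
  | nil => exact refl _
  | cons p v ih =>
    have h := (exchange a p.kind i p.pos).context [] (v.map fun p => ⟨p.kind, i + a.outs + p.pos⟩)
    have h' := ih.context [⟨p.kind, i + a.ins + p.pos⟩] []
    rw [List.append_nil, List.append_nil] at h'
    exact h.trans h'

end IsotopesTo

/-! ### Bent braids modulo 3-move equivalence -/

/-- A word in the standard generators of the braid group on four strands and their inverses. -/
abbrev BraidWord := FreeMonoid (Fin 3 × Bool)

/-- The crossings of a braid on the strands `2, 3, 4, 5`. -/
def braidPieces (w : BraidWord) : List Piece :=
  w.toList.map fun x => crossAt (x.1 + 2) x.2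

theorem braidPieces_mul (v w : BraidWord) :
    braidPieces (v * w) = braidPieces v ++ braidPieces w := by
  simp [braidPieces]

theorem isTangleWord_braidPieces (w : BraidWord) : IsTangleWord 8 (braidPieces w) 8 := by
  induction w using FreeMonoid.inductionOn' with
  | one => rfl
  | of_mul x w ih =>
    rw [braidPieces_mul]
    refine ⟨?_, ih⟩
    have := x.1.isLt
    simp only [crossAt, PieceKind.ins]
    omega

theorem countP_braidPieces (w : BraidWord) :
    (braidPieces w).countP Piece.isCrossing = w.toList.length := by
  rw [braidPieces, List.countP_map, List.countP_eq_length]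
  intro x _
  rfl

/-- The tangle diagram obtained from a braid on four strands by bending the two left upper ends
down and the two right lower ends up. -/
def bentBraid (w : BraidWord) : TangleDiagram 4 4 where
  pieces := [maxAt 0, maxAt 1] ++ braidPieces w ++ [minAt 5, minAt 4]
  isTangleWord := by
    refine isTangleWord_append.2 ⟨8, isTangleWord_append.2 ⟨8, ?_, isTangleWord_braidPieces w⟩, ?_⟩
    all_goals simp [IsTangleWord, maxAt, minAt, PieceKind.ins, PieceKind.outs]

theorem numCrossings_bentBraid (w : BraidWord) : (bentBraid w).numCrossings = w.toList.length := by
  simp [TangleDiagram.numCrossings, bentBraid, List.countP_append, countP_braidPieces,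
    Piece.isCrossing, maxAt, minAt]

/-- Two braid words are equivalent if replacing one by the other as a part of a bent braid gives
3-move equivalent diagrams. -/
def braidCon : Con BraidWord where
  r w w' := ∀ u v, (bentBraid (u * w * v)).ThreeMoveEquivalent (bentBraid (u * w' * v))
  iseqv :=
    { refl := fun _ _ _ => .refl _
      symm := fun h u v => .symm _ _ (h u v)
      trans := fun h h' u v => .trans _ _ _ (h u v) (h' u v) }
  mul' := by
    intro w w' x x' h h' u v
    have e := h u (x * v)
    have e' := h' (u * w') v
    simp only [← mul_assoc] at e e' ⊢
    exact .trans _ _ _ e e'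

theorem braidCon_of_move {w w' : BraidWord}
    (h : PlanarMove (braidPieces w) (braidPieces w') ∨
      ReidemeisterMove (braidPieces w) (braidPieces w') ∨
      ThreeMove (braidPieces w) (braidPieces w')) : braidCon w w' := by
  intro u v
  refine .rel _ _ ⟨[maxAt 0, maxAt 1] ++ braidPieces u, braidPieces w, braidPieces w',
    braidPieces v ++ [minAt 5, minAt 4], h, ?_, ?_⟩
  all_goals simp [bentBraid, braidPieces_mul]

/-- The class of a braid word consisting of one letter. -/
def braidLetter (i : Fin 3) (s : Bool) : braidCon.Quotient :=
  (FreeMonoid.of (i, s) : BraidWord)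

theorem braidLetter_mul_not (i : Fin 3) (s : Bool) :
    braidLetter i s * braidLetter i (!s) = 1 :=
  (Con.eq _).2 (braidCon_of_move (Or.inr (Or.inl (ReidemeisterMove.r2 (i + 2) s))))

theorem braidLetter_cube (i : Fin 3) (s : Bool) :
    braidLetter i s * braidLetter i s * braidLetter i s = 1 :=
  ((Con.eq _).2 (braidCon_of_move (w := 1)
    (w' := FreeMonoid.of (i, s) * FreeMonoid.of (i, s) * FreeMonoid.of (i, s))
    (Or.inr (Or.inr (ThreeMove.twist (i + 2) s))))).symm

/-- A standard generator as an invertible element. -/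
def braidUnit (i : Fin 3) : braidCon.Quotientˣ where
  val := braidLetter i true
  inv := braidLetter i false
  val_inv := braidLetter_mul_not i true
  inv_val := braidLetter_mul_not i false

/-- The braid relations are third Reidemeister moves, the cubes are 3-moves, and the commutation is
a planar exchange. The quotient is only a monoid, so the group argument is applied to its units; the
second Reidemeister move makes the generators invertible. -/
theorem cubicBraidTriple_braidUnit :
    CubicBraidTriple (braidUnit 0) (braidUnit 1) (braidUnit 2) where
  left :=
    { braid := Units.ext ((Con.eq _).2 (braidCon_of_move (Or.inr (Or.inl
        (ReidemeisterMove.r3 2 true true true (Or.inl rfl))))))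
      cube_left := Units.ext (braidLetter_cube 0 true)
      cube_right := Units.ext (braidLetter_cube 1 true) }
  right :=
    { braid := Units.ext ((Con.eq _).2 (braidCon_of_move (Or.inr (Or.inl
        (ReidemeisterMove.r3 3 true true true (Or.inl rfl))))))
      cube_left := Units.ext (braidLetter_cube 1 true)
      cube_right := Units.ext (braidLetter_cube 2 true) }
  comm := Units.ext ((Con.eq _).2 (braidCon_of_move (Or.inl
    (PlanarMove.exchange (.crossing true) (.crossing true) 2 0))))

theorem IsSigned.exists_braidLetter {i : Fin 3} {x : braidCon.Quotientˣ}
    (h : IsSigned (braidUnit i) x) : ∃ s, (x : braidCon.Quotient) = braidLetter i s := by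
  rcases h with rfl | rfl
  exacts [⟨true, rfl⟩, ⟨false, rfl⟩]

theorem exists_isSigned_eq_braidLetter (i : Fin 3) (s : Bool) :
    ∃ x : braidCon.Quotientˣ,
      IsSigned (braidUnit i) x ∧ (x : braidCon.Quotient) = braidLetter i s := by
  cases s
  exacts [⟨_, Or.inr rfl, rfl⟩, ⟨_, Or.inl rfl, rfl⟩]

theorem IsShort.exists_braidWord {k : ℕ} {g : braidCon.Quotientˣ}
    (h : IsShort (braidUnit 0) (braidUnit 1) (braidUnit 2) k g) :
    ∃ w : BraidWord, w.toList.length ≤ k ∧ (w : braidCon.Quotient) = g := by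
  obtain ⟨l, hk, hl, rfl⟩ := h
  suffices H : ∃ w : BraidWord, w.toList.length = l.length ∧ (w : braidCon.Quotient) = l.prod by
    obtain ⟨w, hw, e⟩ := H
    exact ⟨w, hw.trans_le hk, e⟩
  clear hk
  induction l with
  | nil => exact ⟨1, rfl, rfl⟩
  | cons x l ih =>
    obtain ⟨w, hw, e⟩ := ih fun y hy => hl y (List.mem_cons_of_mem _ hy)
    have : ∃ i s, (x : braidCon.Quotient) = braidLetter i s := by
      rcases hl x List.mem_cons_self with h | h | h
      all_goals exact ⟨_, h.exists_braidLetter⟩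
    obtain ⟨i, s, hx⟩ := this
    refine ⟨FreeMonoid.of (i, s) * w, by simp [hw], ?_⟩
    rw [List.prod_cons, Units.val_mul, ← e, hx]
    rfl

/-- Closed up in this way, the braid words with nine letters that underlie the nine vertex
configuration become shorter. -/
theorem exists_shorter_bentBraid (s₁ s₂ s₃ s₄ s₅ s₆ s₇ s₈ s₉ : Bool) :
    ∃ w : BraidWord, w.toList.length ≤ 8 ∧ (bentBraid (FreeMonoid.ofList [(0, s₁), (1, s₂), (2, s₃),
      (1, s₄), (0, s₅), (1, s₆), (2, s₇), (1, s₈), (0, s₉)])).ThreeMoveEquivalent (bentBraid w) := by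
  obtain ⟨x₁, h₁, e₁⟩ := exists_isSigned_eq_braidLetter 0 s₁
  obtain ⟨x₂, h₂, e₂⟩ := exists_isSigned_eq_braidLetter 1 s₂
  obtain ⟨x₃, h₃, e₃⟩ := exists_isSigned_eq_braidLetter 2 s₃
  obtain ⟨x₄, h₄, e₄⟩ := exists_isSigned_eq_braidLetter 1 s₄
  obtain ⟨x₅, h₅, e₅⟩ := exists_isSigned_eq_braidLetter 0 s₅
  obtain ⟨x₆, h₆, e₆⟩ := exists_isSigned_eq_braidLetter 1 s₆
  obtain ⟨x₇, h₇, e₇⟩ := exists_isSigned_eq_braidLetter 2 s₇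
  obtain ⟨x₈, h₈, e₈⟩ := exists_isSigned_eq_braidLetter 1 s₈
  obtain ⟨x₉, h₉, e₉⟩ := exists_isSigned_eq_braidLetter 0 s₉
  obtain ⟨w, hw, e⟩ :=
    (cubicBraidTriple_braidUnit.isShort_nine h₁ h₂ h₃ h₄ h₅ h₆ h₇ h₈ h₉).exists_braidWord
  refine ⟨w, hw, ?_⟩
  simp only [Units.val_mul, e₁, e₂, e₃, e₄, e₅, e₆, e₇, e₈, e₉] at e
  -- The empty context on both sides gives the bent braids themselves.
  have key := (Con.eq braidCon).1 e.symm 1 1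
  rw [one_mul, mul_one, one_mul, mul_one] at key
  exact key

/-! ### The nine vertex configuration as a bent braid -/

open IsotopesTo in
/-- A diagram on the nine vertex configuration is a bent braid. -/
theorem isotopesTo_nineVertexWord (a b c d e f l m r : Bool) :
    IsotopesTo
      [maxAt 0, maxAt 1, crossAt 2 l, crossAt 3 (!e), crossAt 4 (!a), crossAt 3 b, crossAt 2 (!m),
        crossAt 3 c, crossAt 4 (!d), crossAt 3 (!f), crossAt 2 r, minAt 5, minAt 4]
      [maxAt 2, crossAt 1 a, crossAt 3 d, crossAt 0 e, crossAt 4 f, crossAt 1 b, crossAt 3 c,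
        minAt 2, crossAt 1 m, crossAt 0 l, crossAt 2 r] :=
  -- Each slide through a maximum or minimum is a quarter turn and reverses the sign. `L` and `C`
  -- slide twice, `B` and `R` never, and the other five once, which accounts for the negations. `L`,
  -- `R` and `M` first sink to the bottom.
  calc
    IsotopesTo [maxAt 0, maxAt 1, crossAt 2 l, crossAt 3 (!e), crossAt 4 (!a), crossAt 3 b,
      crossAt 2 (!m), crossAt 3 c, crossAt 4 (!d), crossAt 3 (!f), crossAt 2 r, minAt 5, minAt 4]
      [maxAt 0, maxAt 2, crossAt 1 (!l), crossAt 3 (!e), crossAt 4 (!a), crossAt 3 b, crossAt 2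
        (!m), crossAt 3 c, crossAt 4 (!d), crossAt 3 (!f), crossAt 2 r, minAt 5, minAt 4] :=
      (slide_max 1 rfl).context [maxAt 0] [crossAt 3 (!e), crossAt 4 (!a), crossAt 3 b, crossAt 2
        (!m), crossAt 3 c, crossAt 4 (!d), crossAt 3 (!f), crossAt 2 r, minAt 5, minAt 4]
    IsotopesTo _ [maxAt 0, maxAt 0, crossAt 1 (!l), crossAt 3 (!e), crossAt 4 (!a), crossAt 3 b,
      crossAt 2 (!m), crossAt 3 c, crossAt 4 (!d), crossAt 3 (!f), crossAt 2 r, minAt 5, minAt 4]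
      :=
      (exchange .maximum .maximum 0 0).context [] [crossAt 1 (!l), crossAt 3 (!e), crossAt 4 (!a),
        crossAt 3 b, crossAt 2 (!m), crossAt 3 c, crossAt 4 (!d), crossAt 3 (!f), crossAt 2 r,
        minAt 5, minAt 4]
    IsotopesTo _ [maxAt 0, maxAt 1, crossAt 0 l, crossAt 3 (!e), crossAt 4 (!a), crossAt 3 b,
      crossAt 2 (!m), crossAt 3 c, crossAt 4 (!d), crossAt 3 (!f), crossAt 2 r, minAt 5, minAt 4]
      :=
      (slide_max 0 (Bool.not_not l).symm).context [maxAt 0] [crossAt 3 (!e), crossAt 4 (!a),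
        crossAt 3 b, crossAt 2 (!m), crossAt 3 c, crossAt 4 (!d), crossAt 3 (!f), crossAt 2 r,
        minAt 5, minAt 4]
    IsotopesTo _ [maxAt 0, maxAt 1, crossAt 3 (!e), crossAt 4 (!a), crossAt 3 b, crossAt 2 (!m),
      crossAt 3 c, crossAt 4 (!d), crossAt 3 (!f), crossAt 2 r, minAt 5, minAt 4, crossAt 0 l] :=
      (exchange_word (.crossing l) 0 [crossAt 1 (!e), crossAt 2 (!a), crossAt 1 b, crossAt 0 (!m),
        crossAt 1 c, crossAt 2 (!d), crossAt 1 (!f), crossAt 0 r, minAt 3, minAt 2]).context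
        [maxAt 0, maxAt 1] []
    IsotopesTo _ [maxAt 0, maxAt 1, crossAt 3 (!e), crossAt 4 (!a), crossAt 3 b, crossAt 2 (!m),
      crossAt 3 c, crossAt 4 (!d), crossAt 3 (!f), minAt 5, minAt 4, crossAt 2 r, crossAt 0 l] :=
      (exchange_word (.crossing r) 2 [minAt 1, minAt 0]).context [maxAt 0, maxAt 1, crossAt 3
        (!e), crossAt 4 (!a), crossAt 3 b, crossAt 2 (!m), crossAt 3 c, crossAt 4 (!d), crossAt 3
        (!f)] [crossAt 0 l]
    IsotopesTo _ [maxAt 0, maxAt 1, crossAt 3 (!e), crossAt 4 (!a), crossAt 3 b, crossAt 2 (!m),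
      crossAt 3 c, crossAt 4 (!d), crossAt 3 (!f), minAt 5, minAt 4, crossAt 0 l, crossAt 2 r] :=
      (exchange_symm (.crossing l) (.crossing r) 0 0).context [maxAt 0, maxAt 1, crossAt 3 (!e),
        crossAt 4 (!a), crossAt 3 b, crossAt 2 (!m), crossAt 3 c, crossAt 4 (!d), crossAt 3 (!f),
        minAt 5, minAt 4] []
    IsotopesTo _ [maxAt 0, crossAt 1 (!e), crossAt 2 (!a), crossAt 1 b, maxAt 1, crossAt 2 (!m),
      crossAt 3 c, crossAt 4 (!d), crossAt 3 (!f), minAt 5, minAt 4, crossAt 0 l, crossAt 2 r] :=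
      (exchange_word .maximum 1 [crossAt 0 (!e), crossAt 1 (!a), crossAt 0 b]).context [maxAt 0]
        [crossAt 2 (!m), crossAt 3 c, crossAt 4 (!d), crossAt 3 (!f), minAt 5, minAt 4, crossAt 0
        l, crossAt 2 r]
    IsotopesTo _ [maxAt 0, crossAt 1 (!e), crossAt 2 (!a), crossAt 1 b, maxAt 2, crossAt 1 m,
      crossAt 3 c, crossAt 4 (!d), crossAt 3 (!f), minAt 5, minAt 4, crossAt 0 l, crossAt 2 r] :=
      (slide_max 1 (Bool.not_not m).symm).context [maxAt 0, crossAt 1 (!e), crossAt 2 (!a),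
        crossAt 1 b] [crossAt 3 c, crossAt 4 (!d), crossAt 3 (!f), minAt 5, minAt 4, crossAt 0 l,
        crossAt 2 r]
    IsotopesTo _ [maxAt 0, crossAt 1 (!e), crossAt 2 (!a), crossAt 1 b, maxAt 2, crossAt 3 c,
      crossAt 4 (!d), crossAt 3 (!f), minAt 5, minAt 4, crossAt 1 m, crossAt 0 l, crossAt 2 r] :=
      (exchange_word (.crossing m) 1 [crossAt 0 c, crossAt 1 (!d), crossAt 0 (!f), minAt 2,
        minAt 1]).context [maxAt 0, crossAt 1 (!e), crossAt 2 (!a), crossAt 1 b, maxAt 2]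
        [crossAt 0 l, crossAt 2 r]
    -- `E` and `A` turn through the remaining upper maximum; after that `D` and `F` turn through the
    -- two minima.
    IsotopesTo _ [maxAt 1, crossAt 0 e, crossAt 2 (!a), crossAt 1 b, maxAt 2, crossAt 3 c,
      crossAt 4 (!d), crossAt 3 (!f), minAt 5, minAt 4, crossAt 1 m, crossAt 0 l, crossAt 2 r] :=
      (slide_max 0 (Bool.not_not e).symm).context [] [crossAt 2 (!a), crossAt 1 b, maxAt 2,
        crossAt 3 c, crossAt 4 (!d), crossAt 3 (!f), minAt 5, minAt 4, crossAt 1 m, crossAt 0 l,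
        crossAt 2 r]
    IsotopesTo _ [maxAt 1, crossAt 2 (!a), crossAt 0 e, crossAt 1 b, maxAt 2, crossAt 3 c,
      crossAt 4 (!d), crossAt 3 (!f), minAt 5, minAt 4, crossAt 1 m, crossAt 0 l, crossAt 2 r] :=
      (exchange (.crossing e) (.crossing (!a)) 0 0).context [maxAt 1] [crossAt 1 b, maxAt 2,
        crossAt 3 c, crossAt 4 (!d), crossAt 3 (!f), minAt 5, minAt 4, crossAt 1 m, crossAt 0 l,
        crossAt 2 r]
    IsotopesTo _ [maxAt 2, crossAt 1 a, crossAt 0 e, crossAt 1 b, maxAt 2, crossAt 3 c, crossAt 4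
      (!d), crossAt 3 (!f), minAt 5, minAt 4, crossAt 1 m, crossAt 0 l, crossAt 2 r] :=
      (slide_max 1 (Bool.not_not a).symm).context [] [crossAt 0 e, crossAt 1 b, maxAt 2, crossAt 3
        c, crossAt 4 (!d), crossAt 3 (!f), minAt 5, minAt 4, crossAt 1 m, crossAt 0 l, crossAt 2
        r]
    IsotopesTo _ [maxAt 2, crossAt 1 a, crossAt 0 e, crossAt 1 b, maxAt 2, crossAt 3 c, crossAt 4
      (!d), minAt 5, crossAt 3 (!f), minAt 4, crossAt 1 m, crossAt 0 l, crossAt 2 r] :=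
      (exchange (.crossing (!f)) .minimum 3 0).context [maxAt 2, crossAt 1 a, crossAt 0 e,
        crossAt 1 b, maxAt 2, crossAt 3 c, crossAt 4 (!d)] [minAt 4, crossAt 1 m, crossAt 0 l,
        crossAt 2 r]
    IsotopesTo _ [maxAt 2, crossAt 1 a, crossAt 0 e, crossAt 1 b, maxAt 2, crossAt 3 c, crossAt 5
      d, minAt 4, crossAt 3 (!f), minAt 4, crossAt 1 m, crossAt 0 l, crossAt 2 r] :=
      (slide_min_symm 4 (Bool.not_not d).symm).context [maxAt 2, crossAt 1 a, crossAt 0 e,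
        crossAt 1 b, maxAt 2, crossAt 3 c] [crossAt 3 (!f), minAt 4, crossAt 1 m, crossAt 0 l,
        crossAt 2 r]
    IsotopesTo _ [maxAt 2, crossAt 1 a, crossAt 0 e, crossAt 1 b, maxAt 2, crossAt 3 c, crossAt 5
      d, minAt 4, crossAt 4 f, minAt 3, crossAt 1 m, crossAt 0 l, crossAt 2 r] :=
      (slide_min_symm 3 (Bool.not_not f).symm).context [maxAt 2, crossAt 1 a, crossAt 0 e,
        crossAt 1 b, maxAt 2, crossAt 3 c, crossAt 5 d, minAt 4] [crossAt 1 m, crossAt 0 l,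
        crossAt 2 r]
    IsotopesTo _ [maxAt 2, crossAt 1 a, crossAt 0 e, crossAt 1 b, maxAt 2, crossAt 3 c, crossAt 5
      d, crossAt 6 f, minAt 4, minAt 3, crossAt 1 m, crossAt 0 l, crossAt 2 r] :=
      (exchange .minimum (.crossing f) 4 0).context [maxAt 2, crossAt 1 a, crossAt 0 e, crossAt 1
        b, maxAt 2, crossAt 3 c, crossAt 5 d] [minAt 3, crossAt 1 m, crossAt 0 l, crossAt 2 r]
    IsotopesTo _ [maxAt 2, crossAt 1 a, crossAt 0 e, crossAt 1 b, maxAt 2, crossAt 5 d, crossAt 6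
      f, crossAt 3 c, minAt 4, minAt 3, crossAt 1 m, crossAt 0 l, crossAt 2 r] :=
      (exchange_word (.crossing c) 3 [crossAt 0 d, crossAt 1 f]).context [maxAt 2, crossAt 1 a,
        crossAt 0 e, crossAt 1 b, maxAt 2] [minAt 4, minAt 3, crossAt 1 m, crossAt 0 l, crossAt 2
        r]
    IsotopesTo _ [maxAt 2, crossAt 1 a, crossAt 0 e, crossAt 1 b, maxAt 2, crossAt 5 d, crossAt 6
      f, crossAt 4 (!c), minAt 3, minAt 3, crossAt 1 m, crossAt 0 l, crossAt 2 r] :=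
      (slide_min_symm 3 rfl).context [maxAt 2, crossAt 1 a, crossAt 0 e, crossAt 1 b, maxAt 2,
        crossAt 5 d, crossAt 6 f] [minAt 3, crossAt 1 m, crossAt 0 l, crossAt 2 r]
    IsotopesTo _ [maxAt 2, crossAt 1 a, crossAt 0 e, crossAt 1 b, crossAt 3 d, crossAt 4 f,
      crossAt 2 (!c), maxAt 2, minAt 3, minAt 3, crossAt 1 m, crossAt 0 l, crossAt 2 r] :=
      (exchange_word .maximum 2 [crossAt 1 d, crossAt 2 f, crossAt 0 (!c)]).context [maxAt 2,
        crossAt 1 a, crossAt 0 e, crossAt 1 b] [minAt 3, minAt 3, crossAt 1 m, crossAt 0 l,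
        crossAt 2 r]
    -- The bent braid has two maxima and two minima, the configuration one of each; the surplus pair
    -- is a zigzag.
    IsotopesTo _ [maxAt 2, crossAt 1 a, crossAt 0 e, crossAt 1 b, crossAt 3 d, crossAt 4 f,
      crossAt 2 (!c), minAt 3, crossAt 1 m, crossAt 0 l, crossAt 2 r] :=
      (zigzag_right 2).context [maxAt 2, crossAt 1 a, crossAt 0 e, crossAt 1 b, crossAt 3 d,
        crossAt 4 f, crossAt 2 (!c)] [minAt 3, crossAt 1 m, crossAt 0 l, crossAt 2 r]
    IsotopesTo _ [maxAt 2, crossAt 1 a, crossAt 0 e, crossAt 1 b, crossAt 3 d, crossAt 4 f,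
      crossAt 3 c, minAt 2, crossAt 1 m, crossAt 0 l, crossAt 2 r] :=
      (slide_min_symm 2 (Bool.not_not c).symm).context [maxAt 2, crossAt 1 a, crossAt 0 e,
        crossAt 1 b, crossAt 3 d, crossAt 4 f] [crossAt 1 m, crossAt 0 l, crossAt 2 r]
    IsotopesTo _ [maxAt 2, crossAt 1 a, crossAt 0 e, crossAt 3 d, crossAt 4 f, crossAt 1 b,
      crossAt 3 c, minAt 2, crossAt 1 m, crossAt 0 l, crossAt 2 r] :=
      (exchange_word (.crossing b) 1 [crossAt 0 d, crossAt 1 f]).context [maxAt 2, crossAt 1 a,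
        crossAt 0 e] [crossAt 3 c, minAt 2, crossAt 1 m, crossAt 0 l, crossAt 2 r]
    IsotopesTo _ [maxAt 2, crossAt 1 a, crossAt 3 d, crossAt 0 e, crossAt 4 f, crossAt 1 b,
      crossAt 3 c, minAt 2, crossAt 1 m, crossAt 0 l, crossAt 2 r] :=
      (exchange (.crossing e) (.crossing d) 0 1).context [maxAt 2, crossAt 1 a] [crossAt 4 f,
        crossAt 1 b, crossAt 3 c, minAt 2, crossAt 1 m, crossAt 0 l, crossAt 2 r]

theorem Piece.eq_maxAt_of_toGraphPiece {x : Piece} {i : ℕ} (h : x.toGraphPiece = .maximum i) :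
    x = maxAt i := by
  obtain ⟨_ | _ | s, j⟩ := x <;> simp_all [Piece.toGraphPiece, maxAt]

theorem Piece.eq_minAt_of_toGraphPiece {x : Piece} {i : ℕ} (h : x.toGraphPiece = .minimum i) :
    x = minAt i := by
  obtain ⟨_ | _ | s, j⟩ := x <;> simp_all [Piece.toGraphPiece, minAt]

theorem Piece.eq_crossAt_of_toGraphPiece {x : Piece} {i : ℕ} (h : x.toGraphPiece = .vertex i) :
    ∃ s, x = crossAt i s := by
  obtain ⟨_ | _ | s, j⟩ := x <;> simp_all [Piece.toGraphPiece, crossAt]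

theorem exists_eq_nineVertexWord {p : List Piece}
    (h : p.map Piece.toGraphPiece = nineVertexConfiguration) :
    ∃ a b c d e f l m r, p = [maxAt 2, crossAt 1 a, crossAt 3 d, crossAt 0 e, crossAt 4 f,
      crossAt 1 b, crossAt 3 c, minAt 2, crossAt 1 m, crossAt 0 l, crossAt 2 r] := by
  simp only [nineVertexConfiguration, List.map_eq_cons_iff, List.map_eq_nil_iff] at h
  obtain ⟨_, _, rfl, h₁, _, _, rfl, h₂, _, _, rfl, h₃, _, _, rfl, h₄, _, _, rfl, h₅, _, _, rfl, h₆,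
    _, _, rfl, h₇, _, _, rfl, h₈, _, _, rfl, h₉, _, _, rfl, h₁₀, _, _, rfl, h₁₁, rfl⟩ := h
  obtain rfl := Piece.eq_maxAt_of_toGraphPiece h₁
  obtain ⟨a, rfl⟩ := Piece.eq_crossAt_of_toGraphPiece h₂
  obtain ⟨d, rfl⟩ := Piece.eq_crossAt_of_toGraphPiece h₃
  obtain ⟨e, rfl⟩ := Piece.eq_crossAt_of_toGraphPiece h₄
  obtain ⟨f, rfl⟩ := Piece.eq_crossAt_of_toGraphPiece h₅
  obtain ⟨b, rfl⟩ := Piece.eq_crossAt_of_toGraphPiece h₆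
  obtain ⟨c, rfl⟩ := Piece.eq_crossAt_of_toGraphPiece h₇
  obtain rfl := Piece.eq_minAt_of_toGraphPiece h₈
  obtain ⟨m, rfl⟩ := Piece.eq_crossAt_of_toGraphPiece h₉
  obtain ⟨l, rfl⟩ := Piece.eq_crossAt_of_toGraphPiece h₁₀
  obtain ⟨r, rfl⟩ := Piece.eq_crossAt_of_toGraphPiece h₁₁
  exact ⟨a, b, c, d, e, f, l, m, r, rfl⟩

end TangleDiagrams

theorem lemma2p5 (T : TangleDiagram 4 4) (hT : T.SupportedBy nineVertexConfiguration) :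
    T.numCrossings = 9 ∧
      ∃ T' : TangleDiagram 4 4, T.ThreeMoveEquivalent T' ∧ T'.numCrossings < 9 := by
  obtain ⟨⟨p, hp⟩, hTD, hD⟩ := hT
  obtain ⟨a, b, c, d, e, f, l, m, r, rfl⟩ := exists_eq_nineVertexWord hD
  refine ⟨hTD.numCrossings_eq, ?_⟩
  -- The signs are listed in the braid order `L E A B M C D F R`, negated for the vertices that make
  -- one quarter turn.
  obtain ⟨w, hw, h⟩ := exists_shorter_bentBraid l (!e) (!a) b (!m) c (!d) (!f) r
  obtain ⟨_, _, h'⟩ := isotopesTo_nineVertexWord a b c d e f l m r 4 4 (bentBraid <|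
    FreeMonoid.ofList [(0, l), (1, !e), (2, !a), (1, b), (0, !m), (1, c), (2, !d), (1, !f),
      (0, r)]).isTangleWord
  refine ⟨bentBraid w, .trans _ _ _ hTD.threeMoveEquivalent
    (.trans _ _ _ (.symm _ _ h'.threeMoveEquivalent) h), ?_⟩
  rw [numCrossings_bentBraid]
  omega
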